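/- Let $d\ge 2$ and let $\mu$ be a Borel probability measure on the unit sphere $\mathbb S^{d-1}\subset\mathbb R^d$ that minimizes the three-point $1$-frame energy $$I(\nu)=\int_{\mathbb S^{d-1}}\int_{\mathbb S^{d-1}}\int_{\mathbb S^{d-1}}|\langle x,y\rangle\langle x,z\rangle\langle y,z\rangle|\,d\nu(x)\,d\nu(y)\,d\nu(z)$$ over all Borel probability measures $\nu$ on $\mathbb S^{d-1}$. Then the Hausdorff dimension of $\operatorname{supp}(\mu)$ is at most $d-2$. Moreover, for every $c\in\mathbb S^{d-1}$ and every $0<\vartheta<\pi/4$, let $C=\{z\in\mathbb S^{d-1}:\arccos\langle c,z\rangle\le\vartheta\}$ be the closed spherical cap with center $c$ and radius $\vartheta$. Then there is a closed, geodesically convex set $K\subseteq C$ such that $C\cap\operatorname{supp}(\mu)\subseteq\partial K$, where $\partial K$ is the boundary of $K$ relative to $\mathbb S^{d-1}$. Here $K\subseteq\mathbb S^{d-1}$ is called geodesically convex if for any two non-antipodal points of $K$ the shorter great-circle arc joining them is contained in $K$. -/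

import Mathlib

open MeasureTheory
open scoped ENNReal

/-- The unit sphere `S^(d-1)` of `ℝ^d`, with the topology, the (chordal) metric and the Borel
sigma-algebra inherited from `ℝ^d`. -/
abbrev UnitSphere (d : ℕ) : Type :=
  Metric.sphere (0 : EuclideanSpace ℝ (Fin d)) 1

/-- The Euclidean inner product of two points of the unit sphere. -/
noncomputable def sphereInner {d : ℕ} (x y : UnitSphere d) : ℝ :=
  inner ℝ (x : EuclideanSpace ℝ (Fin d)) (y : EuclideanSpace ℝ (Fin d))

/-- The three-point `1`-frame energy of a measure on the unit sphere. The kernel is continuous on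
a compact space, so for a finite measure all the integrals are those of integrable functions. -/
noncomputable def threePointFrameEnergy {d : ℕ} (μ : Measure (UnitSphere d)) : ℝ :=
  ∫ x, ∫ y, ∫ z, |sphereInner x y * sphereInner x z * sphereInner y z| ∂μ ∂μ ∂μ

/-- `μ` is a Borel probability measure on the sphere whose energy is minimal among all Borel
probability measures on the sphere. -/
def IsThreePointFrameMinimizer {d : ℕ} (μ : Measure (UnitSphere d)) : Prop :=
  IsProbabilityMeasure μ ∧
    ∀ ν : Measure (UnitSphere d), IsProbabilityMeasure ν →
      threePointFrameEnergy μ ≤ threePointFrameEnergy ν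

/-- The closed spherical cap with center `c` and angular radius `θ`: the points at spherical
distance `arccos ⟨c, z⟩` at most `θ` from `c`. -/
def sphericalCap {d : ℕ} (c : UnitSphere d) (θ : ℝ) : Set (UnitSphere d) :=
  {z | Real.arccos (sphereInner c z) ≤ θ}

/-- `K` is geodesically convex: for any two non-antipodal points `x, y` of `K`, the minimizing
geodesic between them lies in `K`. That geodesic is the shorter arc of the great circle through
`x` and `y`, i.e. it consists of the points of the sphere of the form `a x + b y`, `a, b ≥ 0`. -/
def IsGeodesicallyConvex {d : ℕ} (K : Set (UnitSphere d)) : Prop :=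
  ∀ x ∈ K, ∀ y ∈ K, (x : EuclideanSpace ℝ (Fin d)) ≠ -(y : EuclideanSpace ℝ (Fin d)) →
    ∀ z : UnitSphere d, ∀ a b : ℝ, 0 ≤ a → 0 ≤ b →
      (z : EuclideanSpace ℝ (Fin d)) =
        a • (x : EuclideanSpace ℝ (Fin d)) + b • (y : EuclideanSpace ℝ (Fin d)) →
      z ∈ K

/-! ### Inner products and chordal distances on the sphere. -/

section SphereBasics

variable {d : ℕ}

/-! Write `A = ∫ z zᵀ dμ`, a matrix of trace 1. Without the absolute value the energy is `tr A³`,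
and `tr A³ ≥ 1/d² + (2/d)‖A - I/d‖²` (`integral_triple_lower_bound`). The uniform measure on an
orthonormal basis has energy `1/d²`, so a minimizer satisfies `A = I/d`, and `⟨x,y⟩⟨x,z⟩⟨y,z⟩ ≥ 0`
throughout its support.

These two facts force every support point `x` to be orthogonal to some support point `z`
(`exists_orthogonal`). If `T` is a part of the support with pairwise positive inner products,
nonnegativity of triples prevents `⟨·,z⟩` from changing sign on `T`, so `z` or `-z` is the normal of
a hemisphere that contains `T` and has `x` on its boundary (`exists_supporting_normal`).

Applied to small balls, this makes the support locally part of the boundary of a convex cone, hence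
locally a Lipschitz image of a subset of a `(d-2)`-dimensional space. Applied to a cap, it places
the support on the boundary of the cap intersected with a spherical convex hull. -/

lemma norm_coe_unitSphere (x : UnitSphere d) : ‖(x : EuclideanSpace ℝ (Fin d))‖ = 1 := by
  simp

lemma sphereInner_self (x : UnitSphere d) : sphereInner x x = 1 := by
  simp [sphereInner]

lemma abs_sphereInner_le_one (x y : UnitSphere d) : |sphereInner x y| ≤ 1 := by
  simpa [sphereInner, norm_coe_unitSphere] using
    abs_real_inner_le_norm (x : EuclideanSpace ℝ (Fin d)) (y : EuclideanSpace ℝ (Fin d))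

@[fun_prop]
lemma Continuous.sphereInner {X : Type*} [TopologicalSpace X] {f g : X → UnitSphere d}
    (hf : Continuous f) (hg : Continuous g) : Continuous fun t => sphereInner (f t) (g t) := by
  unfold _root_.sphereInner
  fun_prop

lemma sphereInner_eq_sum (x y : UnitSphere d) :
    sphereInner x y =
      ∑ i, (x : EuclideanSpace ℝ (Fin d)) i * (y : EuclideanSpace ℝ (Fin d)) i := by
  simp [sphereInner, PiLp.inner_apply, mul_comm]

lemma sum_sq_coe_unitSphere (x : UnitSphere d) :
    ∑ i, (x : EuclideanSpace ℝ (Fin d)) i * (x : EuclideanSpace ℝ (Fin d)) i = 1 := by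
  rw [← sphereInner_eq_sum, sphereInner_self]

lemma dist_sq_eq_two_sub_sphereInner (x y : UnitSphere d) :
    dist x y ^ 2 = 2 - 2 * sphereInner x y := by
  rw [Subtype.dist_eq, dist_eq_norm, norm_sub_sq_real, norm_coe_unitSphere, norm_coe_unitSphere,
    sphereInner]
  ring

lemma sphereInner_pos_of_dist_lt {x y : UnitSphere d} (h : dist x y < 1) :
    0 < sphereInner x y := by
  have h1 := dist_sq_eq_two_sub_sphereInner x y
  have h2 : 0 ≤ dist x y := dist_nonneg
  nlinarith

end SphereBasics

/-! ### Integrals of continuous functions on compact spaces. -/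

section Integration

variable {X : Type*} [TopologicalSpace X] [CompactSpace X] [MeasurableSpace X]
  [OpensMeasurableSpace X] {μ : Measure X}

lemma Continuous.integrable_of_compactSpace {E : Type*} [NormedAddCommGroup E]
    [SecondCountableTopologyEither X E]
    [IsFiniteMeasure μ] {f : X → E} (hf : Continuous f) : Integrable f μ := by
  obtain ⟨C, hC⟩ := isCompact_univ.exists_bound_of_continuousOn hf.continuousOn
  exact Integrable.of_bound hf.aestronglyMeasurable C (.of_forall fun x => hC x trivial)

lemma continuous_integral_of_compactSpace [SecondCountableTopology X] [IsFiniteMeasure μ]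
    {Y : Type*} [TopologicalSpace Y] [FirstCountableTopology Y] [LocallyCompactSpace Y]
    {f : Y → X → ℝ} (hf : Continuous f.uncurry) : Continuous fun y => ∫ x, f y x ∂μ := by
  simpa using continuous_parametric_integral_of_continuous (μ := μ) hf isCompact_univ

/-- A nonnegative continuous function whose integral is not positive vanishes on the support. -/
lemma eq_zero_on_support_of_integral_nonpos [SecondCountableTopology X] [IsFiniteMeasure μ]
    {f : X → ℝ} (hf : Continuous f) (h0 : ∀ x ∈ μ.support, 0 ≤ f x) (hint : ∫ x, f x ∂μ ≤ 0) :
    ∀ x ∈ μ.support, f x = 0 := by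
  have hS : ∀ᵐ x ∂μ, x ∈ μ.support := Measure.support_mem_ae
  have hnn : 0 ≤ᵐ[μ] f := hS.mono h0
  have hz : f =ᵐ[μ] 0 := (integral_eq_zero_iff_of_nonneg_ae hnn hf.integrable_of_compactSpace).1
    (le_antisymm hint (integral_nonneg_of_ae hnn))
  intro x hx
  by_contra hne
  have hU : {y | f y ≠ 0} ∈ nhds x := (isOpen_ne_fun hf continuous_const).mem_nhds hne
  exact ((Measure.mem_support_iff_forall x).1 hx _ hU).ne' hz

end Integration

/-! ### Second moments and the lower bound for the signed energy. -/

section Moments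

variable {d : ℕ}

/-- The second moment matrix of a measure on the sphere. -/
noncomputable def secondMoment (μ : Measure (UnitSphere d)) (i j : Fin d) : ℝ :=
  ∫ z : UnitSphere d,
    (z : EuclideanSpace ℝ (Fin d)) i * (z : EuclideanSpace ℝ (Fin d)) j ∂μ

variable (μ : Measure (UnitSphere d)) [IsProbabilityMeasure μ]

lemma integral_inner_mul_inner (u v : EuclideanSpace ℝ (Fin d)) :
    ∫ z : UnitSphere d, inner ℝ u (z : EuclideanSpace ℝ (Fin d)) *
      inner ℝ v (z : EuclideanSpace ℝ (Fin d)) ∂μ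
      = ∑ i, ∑ j, u i * v j * secondMoment μ i j := by
  have h : ∀ z : UnitSphere d, inner ℝ u (z : EuclideanSpace ℝ (Fin d)) *
      inner ℝ v (z : EuclideanSpace ℝ (Fin d)) = ∑ i, ∑ j, u i * v j *
      ((z : EuclideanSpace ℝ (Fin d)) i * (z : EuclideanSpace ℝ (Fin d)) j) := by
    intro z
    simp only [PiLp.inner_apply, RCLike.inner_apply, conj_trivial, Finset.sum_mul_sum]
    exact Finset.sum_congr rfl fun i _ => Finset.sum_congr rfl fun j _ => by ring
  simp_rw [h]
  rw [integral_finsetSum _ fun i _ => Continuous.integrable_of_compactSpace (by fun_prop)]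
  refine Finset.sum_congr rfl fun i _ => ?_
  rw [integral_finsetSum _ fun i _ => Continuous.integrable_of_compactSpace (by fun_prop)]
  exact Finset.sum_congr rfl fun j _ => integral_const_mul _ _

lemma sum_secondMoment_diag : ∑ i, secondMoment μ i i = 1 := by
  unfold secondMoment
  rw [← integral_finsetSum _ fun i _ => Continuous.integrable_of_compactSpace (by fun_prop)]
  simp [sum_sq_coe_unitSphere]

lemma integral_integral_sphereInner_sq :
    ∫ x, ∫ y, sphereInner x y ^ 2 ∂μ ∂μ = ∑ i, ∑ j, secondMoment μ i j ^ 2 := by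
  have h : ∀ x : UnitSphere d, ∫ y, sphereInner x y ^ 2 ∂μ = ∑ i, ∑ j,
      (x : EuclideanSpace ℝ (Fin d)) i * (x : EuclideanSpace ℝ (Fin d)) j *
        secondMoment μ i j := fun x => by
    simp only [sphereInner, sq]
    exact integral_inner_mul_inner μ _ _
  simp_rw [h]
  rw [integral_finsetSum _ fun i _ => Continuous.integrable_of_compactSpace (by fun_prop)]
  refine Finset.sum_congr rfl fun i _ => ?_
  rw [integral_finsetSum _ fun i _ => Continuous.integrable_of_compactSpace (by fun_prop)]
  refine Finset.sum_congr rfl fun j _ => ?_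
  rw [integral_mul_const, sq]
  rfl

/-- The second moment matrix acting on the sphere. -/
noncomputable def secondMomentApply (x : UnitSphere d) : EuclideanSpace ℝ (Fin d) :=
  ∫ z : UnitSphere d, sphereInner x z • (z : EuclideanSpace ℝ (Fin d)) ∂μ

lemma inner_secondMomentApply (x : UnitSphere d) (v : EuclideanSpace ℝ (Fin d)) :
    inner ℝ v (secondMomentApply μ x) =
      ∫ z : UnitSphere d, sphereInner x z * inner ℝ v (z : EuclideanSpace ℝ (Fin d)) ∂μ := by
  rw [secondMomentApply,
    ← integral_inner (Continuous.integrable_of_compactSpace (by fun_prop))]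
  simp [inner_smul_right]

/-- The signed three-point energy. -/
lemma integral_triple_eq :
    ∫ x, ∫ y, ∫ z, sphereInner x y * sphereInner x z * sphereInner y z ∂μ ∂μ ∂μ =
      ∫ x, ‖secondMomentApply μ x‖ ^ 2 ∂μ := by
  refine integral_congr_ae (.of_forall fun x => ?_)
  have h : ∀ y : UnitSphere d, ∫ z, sphereInner x y * sphereInner x z * sphereInner y z ∂μ =
      sphereInner x y * inner ℝ (secondMomentApply μ x) (y : EuclideanSpace ℝ (Fin d)) := by
    intro y
    rw [real_inner_comm, inner_secondMomentApply, ← integral_const_mul]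
    simp [sphereInner, mul_assoc]
  simp_rw [h]
  rw [← inner_secondMomentApply, real_inner_self_eq_norm_sq]

lemma continuous_secondMomentApply : Continuous (secondMomentApply μ) := by
  have : ∀ x, secondMomentApply μ x =
      ∫ z : UnitSphere d in Set.univ, sphereInner x z • (z : EuclideanSpace ℝ (Fin d)) ∂μ := by
    simp [secondMomentApply]
  simp_rw [funext this]
  exact continuous_parametric_integral_of_continuous
    (by simp only [Function.uncurry_def]; fun_prop) isCompact_univ

/-- Expanding `∫ ‖A x - x/d‖² dμ ≥ 0` gives `tr A³ ≥ (2/d) tr A² - 1/d²`, and `tr A = 1` gives `tr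
A² = ‖A - I/d‖² + 1/d`. -/
lemma integral_triple_lower_bound (hd : 0 < d) :
    1 / (d : ℝ) ^ 2 + 2 / d * ∑ i, ∑ j, (secondMoment μ i j - if i = j then 1 / (d : ℝ) else 0) ^ 2
      ≤ ∫ x, ∫ y, ∫ z, sphereInner x y * sphereInner x z * sphereInner y z ∂μ ∂μ ∂μ := by
  have hd' : (0 : ℝ) < d := by exact_mod_cast hd
  have hc := continuous_secondMomentApply μ
  have hsq : ∑ i, ∑ j, (secondMoment μ i j - if i = j then 1 / (d : ℝ) else 0) ^ 2 =
      ∑ i, ∑ j, secondMoment μ i j ^ 2 - 1 / d := by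
    have h : ∀ i j, (secondMoment μ i j - if i = j then 1 / (d : ℝ) else 0) ^ 2 =
        secondMoment μ i j ^ 2 +
          (if i = j then (-2 / d * secondMoment μ i j + 1 / (d : ℝ) ^ 2) else 0) := by
      intro i j
      split_ifs <;> ring
    simp_rw [h, Finset.sum_add_distrib]
    simp only [Finset.sum_ite_eq, Finset.mem_univ, if_true, Finset.sum_add_distrib,
      ← Finset.mul_sum, sum_secondMoment_diag]
    simp
    field_simp
    ring
  have hnn : 0 ≤ ∫ x : UnitSphere d,
      ‖secondMomentApply μ x - (1 / (d : ℝ)) • (x : EuclideanSpace ℝ (Fin d))‖ ^ 2 ∂μ :=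
    integral_nonneg fun x => by positivity
  have hexp : ∀ x : UnitSphere d,
      ‖secondMomentApply μ x - (1 / (d : ℝ)) • (x : EuclideanSpace ℝ (Fin d))‖ ^ 2 =
      ‖secondMomentApply μ x‖ ^ 2 - 2 / d * ∫ z, sphereInner x z ^ 2 ∂μ + 1 / (d : ℝ) ^ 2 := by
    intro x
    have h1 := inner_secondMomentApply μ x (x : EuclideanSpace ℝ (Fin d))
    rw [norm_sub_sq_real, real_inner_smul_right, real_inner_comm, h1, norm_smul,
      norm_coe_unitSphere]
    simp only [sphereInner, sq, Real.norm_eq_abs, mul_one, abs_mul_abs_self]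
    ring
  have hcont : Continuous fun x : UnitSphere d => ∫ z, sphereInner x z ^ 2 ∂μ :=
    continuous_integral_of_compactSpace (by simp only [Function.uncurry_def]; fun_prop)
  simp_rw [hexp] at hnn
  rw [integral_add (Continuous.integrable_of_compactSpace (by fun_prop))
      (integrable_const _),
    integral_sub (Continuous.integrable_of_compactSpace (by fun_prop))
      (Continuous.integrable_of_compactSpace (by fun_prop)),
    integral_const_mul, integral_integral_sphereInner_sq] at hnn
  simp only [integral_const, probReal_univ, one_smul] at hnn
  rw [integral_triple_eq, hsq]
  have : 2 / (d : ℝ) * (1 / d) = 2 * (1 / (d : ℝ) ^ 2) := by field_simp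
  linarith

end Moments

/-! ### The competitor: an orthonormal basis with equal weights. -/

section OrthonormalMeasure

variable {d : ℕ}

/-- The points of the standard orthonormal basis. -/
noncomputable def basisPoint (i : Fin d) : UnitSphere d :=
  ⟨EuclideanSpace.single i 1, by simp⟩

lemma sphereInner_basisPoint (i j : Fin d) :
    sphereInner (basisPoint i) (basisPoint j) = if i = j then 1 else 0 := by
  simp [sphereInner, basisPoint, EuclideanSpace.inner_single_left]

/-- The uniform probability measure on the standard orthonormal basis. -/
noncomputable def orthonormalMeasure (d : ℕ) : Measure (UnitSphere d) :=
  (d : ℝ≥0∞)⁻¹ • ∑ i : Fin d, Measure.dirac (basisPoint i)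

lemma isProbabilityMeasure_orthonormalMeasure (hd : 0 < d) :
    IsProbabilityMeasure (orthonormalMeasure d) := by
  constructor
  simp [orthonormalMeasure, ENNReal.inv_mul_cancel, hd.ne']

lemma integral_orthonormalMeasure (f : UnitSphere d → ℝ) :
    ∫ x, f x ∂(orthonormalMeasure d) = (d : ℝ)⁻¹ * ∑ i, f (basisPoint i) := by
  rw [orthonormalMeasure, integral_smul_measure,
    integral_finsetSum_measure fun i _ => integrable_dirac (by simp)]
  simp

/-- Only the `d` triples `i = j = k` contribute, each with weight `d⁻³`. -/
lemma threePointFrameEnergy_orthonormalMeasure (hd : 0 < d) :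
    threePointFrameEnergy (orthonormalMeasure d) = 1 / (d : ℝ) ^ 2 := by
  have hd' : (d : ℝ) ≠ 0 := by exact_mod_cast hd.ne'
  simp only [threePointFrameEnergy, integral_orthonormalMeasure, sphereInner_basisPoint]
  have h : ∀ i : Fin d, ∑ j : Fin d, (d : ℝ)⁻¹ * ∑ k : Fin d,
      |((if i = j then (1 : ℝ) else 0) * if i = k then 1 else 0) * if j = k then 1 else 0|
      = (d : ℝ)⁻¹ := by
    intro i
    rw [Finset.sum_eq_single i, Finset.sum_eq_single i]
    · simp
    · intro k _ hk
      simp [hk.symm]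
    · simp
    · intro j _ hj
      simp [hj.symm]
    · simp
  simp only [h]
  simp
  field_simp

end OrthonormalMeasure

/-! ### Isotropy, sign condition and supporting normals for minimizers. -/

section Minimizers

variable {d : ℕ} {μ : Measure (UnitSphere d)}

lemma integral_abs_triple_sub_triple [IsProbabilityMeasure μ] :
    0 ≤ ∫ x, ∫ y, ∫ z, (|sphereInner x y * sphereInner x z * sphereInner y z| -
        sphereInner x y * sphereInner x z * sphereInner y z) ∂μ ∂μ ∂μ ∧
    ∫ x, ∫ y, ∫ z, (|sphereInner x y * sphereInner x z * sphereInner y z| -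
        sphereInner x y * sphereInner x z * sphereInner y z) ∂μ ∂μ ∂μ =
      threePointFrameEnergy μ -
        ∫ x, ∫ y, ∫ z, sphereInner x y * sphereInner x z * sphereInner y z ∂μ ∂μ ∂μ := by
  refine ⟨integral_nonneg fun x => integral_nonneg fun y => integral_nonneg fun z =>
    sub_nonneg.2 (le_abs_self _), ?_⟩
  have c1 : Continuous fun p : UnitSphere d × UnitSphere d =>
      ∫ z, |sphereInner p.1 p.2 * sphereInner p.1 z * sphereInner p.2 z| ∂μ :=
    continuous_integral_of_compactSpace (by simp only [Function.uncurry_def]; fun_prop)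
  have c2 : Continuous fun p : UnitSphere d × UnitSphere d =>
      ∫ z, sphereInner p.1 p.2 * sphereInner p.1 z * sphereInner p.2 z ∂μ :=
    continuous_integral_of_compactSpace (by simp only [Function.uncurry_def]; fun_prop)
  have c3 : Continuous fun x : UnitSphere d =>
      ∫ y, ∫ z, |sphereInner x y * sphereInner x z * sphereInner y z| ∂μ ∂μ :=
    continuous_integral_of_compactSpace c1
  have c4 : Continuous fun x : UnitSphere d =>
      ∫ y, ∫ z, sphereInner x y * sphereInner x z * sphereInner y z ∂μ ∂μ :=
    continuous_integral_of_compactSpace c2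
  rw [threePointFrameEnergy, ← integral_sub c3.integrable_of_compactSpace
    c4.integrable_of_compactSpace]
  refine integral_congr_ae (.of_forall fun x => ?_)
  dsimp only
  have c5 := c1.comp (Continuous.prodMk_right x)
  have c6 := c2.comp (Continuous.prodMk_right x)
  simp only [Function.comp_def] at c5 c6
  rw [← integral_sub c5.integrable_of_compactSpace c6.integrable_of_compactSpace]
  refine integral_congr_ae (.of_forall fun y => ?_)
  exact integral_sub (Continuous.integrable_of_compactSpace (by fun_prop))
    (Continuous.integrable_of_compactSpace (by fun_prop))

/-- The second moment matrix of a minimizer is a multiple of the identity. -/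
lemma IsThreePointFrameMinimizer.secondMoment_eq (hd : 0 < d)
    (hμ : IsThreePointFrameMinimizer μ) (i j : Fin d) :
    secondMoment μ i j = if i = j then 1 / (d : ℝ) else 0 := by
  have := hμ.1
  have hd' : (0 : ℝ) < d := by exact_mod_cast hd
  have h1 := hμ.2 _ (isProbabilityMeasure_orthonormalMeasure hd)
  rw [threePointFrameEnergy_orthonormalMeasure hd] at h1
  obtain ⟨h2, h3⟩ := integral_abs_triple_sub_triple (μ := μ)
  have h4 := integral_triple_lower_bound μ hd
  have h5 : ∑ i, ∑ j, (secondMoment μ i j - if i = j then 1 / (d : ℝ) else 0) ^ 2 ≤ 0 := by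
    by_contra! h
    have : 0 < 2 / (d : ℝ) *
      ∑ i, ∑ j, (secondMoment μ i j - if i = j then 1 / (d : ℝ) else 0) ^ 2 := by positivity
    linarith
  have h6 : ∀ i ∈ Finset.univ,
      0 ≤ ∑ j, (secondMoment μ i j - if i = j then 1 / (d : ℝ) else 0) ^ 2 :=
    fun i _ => Finset.sum_nonneg fun j _ => sq_nonneg _
  have h7 := (Finset.sum_eq_zero_iff_of_nonneg h6).1 (le_antisymm h5 (Finset.sum_nonneg h6))
    i (Finset.mem_univ i)
  have h8 := (Finset.sum_eq_zero_iff_of_nonneg fun j _ => sq_nonneg _).1 h7 j (Finset.mem_univ j)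
  exact sub_eq_zero.1 (pow_eq_zero_iff two_ne_zero |>.1 h8)

/-- A minimizer is an isotropic measure (a tight frame). -/
lemma IsThreePointFrameMinimizer.integral_inner_mul_inner_eq (hd : 0 < d)
    (hμ : IsThreePointFrameMinimizer μ) (u v : EuclideanSpace ℝ (Fin d)) :
    ∫ z : UnitSphere d, inner ℝ u (z : EuclideanSpace ℝ (Fin d)) *
      inner ℝ v (z : EuclideanSpace ℝ (Fin d)) ∂μ = inner ℝ u v / d := by
  have := hμ.1
  rw [integral_inner_mul_inner]
  simp only [hμ.secondMoment_eq hd, mul_ite, mul_zero, Finset.sum_ite_eq, Finset.mem_univ, if_true]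
  rw [← Finset.sum_mul, mul_one_div, PiLp.inner_apply]
  simp [mul_comm]

/-- The signed energy is at least `1/d²` and the energy at most `1/d²`, so the continuous
nonnegative function `|t| - t` of the triple product `t` integrates to zero. It therefore vanishes
on the support, one variable at a time. -/
lemma IsThreePointFrameMinimizer.triple_nonneg (hd : 0 < d)
    (hμ : IsThreePointFrameMinimizer μ) {x y z : UnitSphere d} (hx : x ∈ μ.support)
    (hy : y ∈ μ.support) (hz : z ∈ μ.support) :
    0 ≤ sphereInner x y * sphereInner x z * sphereInner y z := by
  have := hμ.1
  have hd' : (0 : ℝ) < d := by exact_mod_cast hd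
  have h1 := hμ.2 _ (isProbabilityMeasure_orthonormalMeasure hd)
  rw [threePointFrameEnergy_orthonormalMeasure hd] at h1
  obtain ⟨-, h3⟩ := integral_abs_triple_sub_triple (μ := μ)
  have h4 := integral_triple_lower_bound μ hd
  have h5 : 0 ≤ 2 / (d : ℝ) *
    ∑ i, ∑ j, (secondMoment μ i j - if i = j then 1 / (d : ℝ) else 0) ^ 2 := by positivity
  have c1 : Continuous fun p : UnitSphere d × UnitSphere d =>
      ∫ z, (|sphereInner p.1 p.2 * sphereInner p.1 z * sphereInner p.2 z| -
        sphereInner p.1 p.2 * sphereInner p.1 z * sphereInner p.2 z) ∂μ :=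
    continuous_integral_of_compactSpace (by simp only [Function.uncurry_def]; fun_prop)
  have c2 : Continuous fun x : UnitSphere d =>
      ∫ y, ∫ z, (|sphereInner x y * sphereInner x z * sphereInner y z| -
        sphereInner x y * sphereInner x z * sphereInner y z) ∂μ ∂μ :=
    continuous_integral_of_compactSpace c1
  have e1 := eq_zero_on_support_of_integral_nonpos c2 (fun x _ => integral_nonneg fun y =>
    integral_nonneg fun z => sub_nonneg.2 (le_abs_self _)) (by linarith) x hx
  have e2 := eq_zero_on_support_of_integral_nonpos (c1.comp (Continuous.prodMk_right x))
    (fun y _ => integral_nonneg fun z => sub_nonneg.2 (le_abs_self _)) e1.le y hy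
  have e3 := eq_zero_on_support_of_integral_nonpos (by fun_prop)
    (fun z _ => sub_nonneg.2 (le_abs_self _)) e2.le z hz
  exact abs_eq_self.1 (sub_eq_zero.1 e3)

/-- Every point of the support of a minimizer is orthogonal to another point of the support. -/
lemma IsThreePointFrameMinimizer.exists_orthogonal (hd : 2 ≤ d)
    (hμ : IsThreePointFrameMinimizer μ) {x : UnitSphere d} (hx : x ∈ μ.support) :
    ∃ z ∈ μ.support, sphereInner x z = 0 := by
  have := hμ.1
  have hd0 : 0 < d := by omega
  have hd' : (2 : ℝ) ≤ d := by exact_mod_cast hd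
  by_contra! hne
  have hS : ∀ᵐ y ∂μ, y ∈ μ.support := Measure.support_mem_ae
  -- The sign of `⟨x,z⟩`; the value at zero is immaterial, since `hne` excludes zero on the support.
  let s : UnitSphere d → ℝ := fun z => if 0 < sphereInner x z then 1 else -1
  have hsm : Measurable s := by
    refine Measurable.ite ?_ measurable_const measurable_const
    exact (isOpen_lt continuous_const (by fun_prop)).measurableSet
  have hsb : ∀ z, ‖s z‖ ≤ 1 := fun z => by
    by_cases h : 0 < sphereInner x z <;> simp [s, h]
  have hs2 : ∀ z, s z * s z = 1 := fun z => by
    by_cases h : 0 < sphereInner x z <;> simp [s, h]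
  have habs : ∀ y ∈ μ.support, ∀ z ∈ μ.support,
      |sphereInner y z| = s y * s z * sphereInner y z := by
    intro y hy z hz
    have h := hμ.triple_nonneg hd0 hx hy hz
    rcases lt_or_gt_of_ne (hne y hy) with h1 | h1 <;>
      rcases lt_or_gt_of_ne (hne z hz) with h2 | h2 <;>
      simp only [s, h1, h2, h1.not_gt, h2.not_gt, if_true, if_false]
    · rw [abs_of_nonneg (nonneg_of_mul_nonneg_right h (mul_pos_of_neg_of_neg h1 h2))]; ring
    · rw [abs_of_nonpos (nonpos_of_mul_nonneg_right h (mul_neg_of_neg_of_pos h1 h2))]; ring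
    · rw [abs_of_nonpos (nonpos_of_mul_nonneg_right h (mul_neg_of_pos_of_neg h1 h2))]; ring
    · rw [abs_of_nonneg (nonneg_of_mul_nonneg_right h (mul_pos h1 h2))]; ring
  have hint : Integrable (fun z : UnitSphere d => s z • (z : EuclideanSpace ℝ (Fin d))) μ :=
    Integrable.of_bound (hsm.smul measurable_subtype_coe).aestronglyMeasurable 1
      (.of_forall fun z => by rw [norm_smul, norm_coe_unitSphere, mul_one]; exact hsb z)
  set b : EuclideanSpace ℝ (Fin d) := ∫ z : UnitSphere d, s z • (z : EuclideanSpace ℝ (Fin d)) ∂μ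
    with hb
  have hinner : ∀ v : EuclideanSpace ℝ (Fin d),
      ∫ z : UnitSphere d, s z * inner ℝ v (z : EuclideanSpace ℝ (Fin d)) ∂μ = inner ℝ v b := by
    intro v
    rw [hb, ← integral_inner hint]
    simp [inner_smul_right]
  have habsint : ∫ y, ∫ z, |sphereInner y z| ∂μ ∂μ = ‖b‖ ^ 2 := by
    rw [← real_inner_self_eq_norm_sq, ← hinner b]
    refine integral_congr_ae (hS.mono fun y hy => ?_)
    dsimp only
    rw [real_inner_comm, ← hinner, ← integral_const_mul]
    refine integral_congr_ae (hS.mono fun z hz => ?_)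
    dsimp only
    rw [habs y hy z hz, sphereInner, mul_assoc]
  -- By isotropy, `∫ (⟨b,z⟩ - ‖b‖² s(z))² dμ = ‖b‖²/d - ‖b‖⁴`.
  have hble : ‖b‖ ^ 2 ≤ 1 / d := by
    have h0 : 0 ≤ ∫ z : UnitSphere d,
        (inner ℝ b (z : EuclideanSpace ℝ (Fin d)) - ‖b‖ ^ 2 * s z) ^ 2 ∂μ :=
      integral_nonneg fun z => sq_nonneg _
    have h1 : ∀ z : UnitSphere d,
        (inner ℝ b (z : EuclideanSpace ℝ (Fin d)) - ‖b‖ ^ 2 * s z) ^ 2 =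
        inner ℝ b (z : EuclideanSpace ℝ (Fin d)) * inner ℝ b (z : EuclideanSpace ℝ (Fin d)) -
          2 * ‖b‖ ^ 2 * (s z * inner ℝ b (z : EuclideanSpace ℝ (Fin d))) + ‖b‖ ^ 4 := by
      intro z
      linear_combination ‖b‖ ^ 4 * hs2 z
    have hi : Integrable (fun z : UnitSphere d =>
        s z * inner ℝ b (z : EuclideanSpace ℝ (Fin d))) μ := by
      refine (hint.const_inner (𝕜 := ℝ) b).congr (.of_forall fun z => ?_)
      simp [inner_smul_right]
    have hq : Integrable (fun z : UnitSphere d => inner ℝ b (z : EuclideanSpace ℝ (Fin d)) *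
        inner ℝ b (z : EuclideanSpace ℝ (Fin d))) μ :=
      Continuous.integrable_of_compactSpace (by fun_prop)
    simp_rw [h1] at h0
    rw [integral_add (f := fun z : UnitSphere d => inner ℝ b (z : EuclideanSpace ℝ (Fin d)) *
        inner ℝ b (z : EuclideanSpace ℝ (Fin d)) -
          2 * ‖b‖ ^ 2 * (s z * inner ℝ b (z : EuclideanSpace ℝ (Fin d))))
        (hq.sub (hi.const_mul _)) (integrable_const _),
      integral_sub hq (hi.const_mul _),
      integral_const_mul, hinner, hμ.integral_inner_mul_inner_eq hd0,
      real_inner_self_eq_norm_sq] at h0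
    simp only [integral_const, probReal_univ, one_smul] at h0
    have h2 : 0 ≤ ‖b‖ ^ 2 * (1 / d - ‖b‖ ^ 2) := by
      calc (0 : ℝ) ≤ _ := h0
        _ = _ := by ring
    by_contra! h
    have : 0 < ‖b‖ ^ 2 := lt_trans (by positivity) h
    nlinarith
  have hsq : ∀ y : UnitSphere d, ∫ z, sphereInner y z ^ 2 ∂μ = 1 / d := by
    intro y
    have h := hμ.integral_inner_mul_inner_eq hd0 (y : EuclideanSpace ℝ (Fin d)) y
    rw [real_inner_self_eq_norm_sq, norm_coe_unitSphere, one_pow] at h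
    simpa only [sphereInner, sq] using h
  -- Since `∬ |⟨y,z⟩| ≤ 1/d = ∬ ⟨y,z⟩²`, equality holds in `t² ≤ |t|` on the support. Then `|⟨x,z⟩|
  -- = 1` for all support points `z`, and `∫ ⟨x,z⟩² = 1` contradicts `1/d`.
  have hle : ∀ y z : UnitSphere d, 0 ≤ |sphereInner y z| - sphereInner y z ^ 2 := by
    intro y z
    nlinarith [abs_sphereInner_le_one y z, abs_nonneg (sphereInner y z),
      sq_abs (sphereInner y z)]
  have c1 : Continuous fun y : UnitSphere d => ∫ z, |sphereInner y z| ∂μ :=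
    continuous_integral_of_compactSpace (by simp only [Function.uncurry_def]; fun_prop)
  have c2 : Continuous fun y : UnitSphere d =>
      ∫ z, (|sphereInner y z| - sphereInner y z ^ 2) ∂μ :=
    continuous_integral_of_compactSpace (by simp only [Function.uncurry_def]; fun_prop)
  have hsplit : ∀ y : UnitSphere d, ∫ z, (|sphereInner y z| - sphereInner y z ^ 2) ∂μ =
      ∫ z, |sphereInner y z| ∂μ - 1 / d := by
    intro y
    rw [integral_sub (Continuous.integrable_of_compactSpace (by fun_prop))
      (Continuous.integrable_of_compactSpace (by fun_prop)), hsq]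
  have e1 := eq_zero_on_support_of_integral_nonpos c2
    (fun y _ => integral_nonneg fun z => hle y z) (by
      simp_rw [hsplit]
      rw [integral_sub c1.integrable_of_compactSpace (integrable_const _), habsint]
      simpa using hble) x hx
  have e2 := eq_zero_on_support_of_integral_nonpos (by fun_prop) (fun z _ => hle x z) e1.le
  have h1 : ∫ z, sphereInner x z ^ 2 ∂μ = 1 := by
    rw [integral_congr_ae (g := fun _ => (1 : ℝ)) (hS.mono fun z hz => ?_)]
    · simp
    · have h3 := e2 z hz
      have h4 : |sphereInner x z| = 1 := by
        have h5 : |sphereInner x z| ≠ 0 := abs_ne_zero.2 (hne z hz)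
        rw [← sq_abs] at h3
        have : |sphereInner x z| * (1 - |sphereInner x z|) = 0 := by linear_combination h3
        rcases mul_eq_zero.1 this with h | h
        · exact absurd h h5
        · linarith
      dsimp only
      rw [← sq_abs, h4, one_pow]
  rw [hsq, div_eq_one_iff_eq (by positivity)] at h1
  linarith

/-- A part of the support with pairwise positive inner products has a supporting hyperplane
through the origin at each of its points. -/
lemma IsThreePointFrameMinimizer.exists_supporting_normal (hd : 2 ≤ d)
    (hμ : IsThreePointFrameMinimizer μ) {T : Set (UnitSphere d)} (hT : T ⊆ μ.support)
    (hpos : ∀ x ∈ T, ∀ y ∈ T, 0 < sphereInner x y) {x : UnitSphere d} (hx : x ∈ T) :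
    ∃ n : UnitSphere d, sphereInner x n = 0 ∧ ∀ y ∈ T, 0 ≤ sphereInner y n := by
  obtain ⟨z, hz, hxz⟩ := hμ.exists_orthogonal hd (hT hx)
  by_cases h : ∀ y ∈ T, 0 ≤ sphereInner y z
  · exact ⟨z, hxz, h⟩
  · push Not at h
    obtain ⟨w, hw, hwz⟩ := h
    -- One point `w` with `⟨w,z⟩ < 0` makes `⟨y,z⟩ ≤ 0` for every `y ∈ T`, because `⟨w,y⟩ > 0`.
    refine ⟨-z, by simpa [sphereInner] using hxz, fun y hy => ?_⟩
    have h1 := hμ.triple_nonneg (by omega) (hT hw) (hT hy) hz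
    have h2 : sphereInner y z ≤ 0 :=
      nonpos_of_mul_nonneg_right h1 (mul_neg_of_pos_of_neg (hpos w hw y hy) hwz)
    simpa [sphereInner] using h2

end Minimizers

/-! ### Supporting normals bound the Hausdorff dimension. -/

section Dimension

variable {d : ℕ}

/-- A subset of the sphere, close to `x₀`, with supporting normals close to `n₀` has Hausdorff
dimension at most `d - 2`. -/
lemma dimH_le_of_supporting_normals {A : Set (UnitSphere d)} {x₀ n₀ : UnitSphere d}
    (h0 : sphereInner x₀ n₀ = 0)
    (hA : ∀ x ∈ A, dist x x₀ < 1 / 4 ∧ ∃ n : UnitSphere d, dist n n₀ < 1 / 4 ∧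
      sphereInner x n = 0 ∧ ∀ y ∈ A, 0 ≤ sphereInner y n) :
    dimH A ≤ ((d - 2 : ℕ) : ℝ≥0∞) := by
  let E := EuclideanSpace ℝ (Fin d)
  let e : Fin 2 → E := ![x₀, n₀]
  have he : Orthonormal ℝ e := by
    have h0' : inner ℝ (n₀ : E) (x₀ : E) = 0 := by rw [real_inner_comm]; exact h0
    have h0'' : inner ℝ (x₀ : E) (n₀ : E) = 0 := h0
    refine ⟨fun i => ?_, fun i j hij => ?_⟩
    · fin_cases i
      · exact norm_coe_unitSphere x₀
      · exact norm_coe_unitSphere n₀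
    · fin_cases i <;> fin_cases j <;> simp_all [e]
  let U : Submodule ℝ E := Submodule.span ℝ (Set.range e)
  have hU : Module.finrank ℝ U = 2 := by
    simpa using finrank_span_eq_card he.linearIndependent
  have hrank : Module.finrank ℝ Uᗮ = d - 2 := by
    have h := U.finrank_add_finrank_orthogonal
    rw [hU, finrank_euclideanSpace_fin] at h
    omega
  let P : E →L[ℝ] Uᗮ := Uᗮ.orthogonalProjectionOnto
  have hP : ∀ v : E, ‖v‖ ≤ ‖P v‖ + (|inner ℝ (x₀ : E) v| + |inner ℝ (n₀ : E) v|) := by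
    intro v
    have hx₀ : (x₀ : E) ∈ U := Submodule.subset_span ⟨0, rfl⟩
    have hn₀ : (n₀ : E) ∈ U := Submodule.subset_span ⟨1, rfl⟩
    set w : E := v - (inner ℝ (x₀ : E) v • (x₀ : E) + inner ℝ (n₀ : E) v • (n₀ : E)) with hw
    have hwU : w ∈ Uᗮ := by
      rw [Submodule.mem_orthogonal]
      intro u hu
      induction hu using Submodule.span_induction with
      | mem u hu =>
        obtain ⟨i, rfl⟩ := hu
        have h0' : inner ℝ (n₀ : E) (x₀ : E) = 0 := by rw [real_inner_comm]; exact h0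
        have h0'' : inner ℝ (x₀ : E) (n₀ : E) = 0 := h0
        fin_cases i <;>
          simp [e, hw, inner_sub_right, inner_add_right, inner_smul_right, h0', h0'']
      | zero => simp
      | add u v _ _ hu hv => rw [inner_add_left, hu, hv, add_zero]
      | smul a u _ hu => rw [inner_smul_left, hu, mul_zero]
    have hPU : ∀ u ∈ U, P u = 0 := fun u hu =>
      Submodule.orthogonalProjectionOnto_orthogonal_apply_eq_zero hu
    have hPv : ‖P v‖ = ‖w‖ := by
      have hPw : P w = P v := by
        rw [hw, map_sub, hPU _ (U.add_mem (U.smul_mem _ hx₀) (U.smul_mem _ hn₀)), sub_zero]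
      rw [← hPw, Submodule.orthogonalProjectionOnto_mem_subspace_eq_self (⟨w, hwU⟩ : Uᗮ)]
      rfl
    have hv : v = w + (inner ℝ (x₀ : E) v • (x₀ : E) + inner ℝ (n₀ : E) v • (n₀ : E)) := by
      rw [hw, sub_add_cancel]
    calc ‖v‖ = ‖w + (inner ℝ (x₀ : E) v • (x₀ : E) + inner ℝ (n₀ : E) v • (n₀ : E))‖ := by
          rw [← hv]
      _ ≤ ‖w‖ + (‖inner ℝ (x₀ : E) v • (x₀ : E)‖ + ‖inner ℝ (n₀ : E) v • (n₀ : E)‖) :=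
          (norm_add_le _ _).trans (by gcongr; exact norm_add_le _ _)
      _ = _ := by
          rw [hPv, norm_smul, norm_smul, norm_coe_unitSphere, norm_coe_unitSphere, mul_one,
            mul_one, Real.norm_eq_abs, Real.norm_eq_abs]
  -- With `v = x - y`, the components along `x₀` and `n₀` are each at most `‖v‖/4`, so `‖v‖ ≤ ‖P v‖
  -- + ‖v‖/2`.
  have hanti : AntilipschitzWith 2 fun x : A => P ((x : UnitSphere d) : E) := by
    refine AntilipschitzWith.of_le_mul_dist fun x y => ?_
    obtain ⟨hx, n, hn, hxn, hAn⟩ := hA x x.2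
    obtain ⟨hy, m, hm, hym, hAm⟩ := hA y y.2
    have hyn := hAn y y.2
    have hxm := hAm x x.2
    set v : E := ((x : UnitSphere d) : E) - ((y : UnitSphere d) : E) with hv
    have hdist : dist x y = ‖v‖ := by rw [Subtype.dist_eq, Subtype.dist_eq, dist_eq_norm]
    have hcs : ∀ a : E, ‖a‖ ≤ 1 / 4 → |inner ℝ a v| ≤ 1 / 4 * ‖v‖ := fun a ha =>
      (abs_real_inner_le_norm a v).trans (by gcongr)
    rw [Subtype.dist_eq, dist_eq_norm] at hx hy hn hm
    -- The vector `x + y` is orthogonal to `v`, and `x₀` is within `1/4` of the midpoint.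
    have hx0 : |inner ℝ (x₀ : E) v| ≤ 1 / 4 * ‖v‖ := by
      have h1 := hcs ((x₀ : E) - (1 / 2 : ℝ) • (((x : UnitSphere d) : E) + (y : UnitSphere d))) (by
        have : (x₀ : E) - (1 / 2 : ℝ) • (((x : UnitSphere d) : E) + (y : UnitSphere d)) =
          (1 / 2 : ℝ) • (-(((x : UnitSphere d) : E) - x₀) + -(((y : UnitSphere d) : E) - x₀)) := by
          module
        rw [this, norm_smul]
        have := norm_add_le (-(((x : UnitSphere d) : E) - x₀)) (-(((y : UnitSphere d) : E) - x₀))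
        rw [norm_neg, norm_neg] at this
        rw [Real.norm_of_nonneg (by norm_num)]
        linarith)
      have h2 : inner ℝ (((x : UnitSphere d) : E) + (y : UnitSphere d)) v = 0 := by
        rw [hv, real_inner_add_sub_eq_zero_iff, norm_coe_unitSphere, norm_coe_unitSphere]
      rwa [inner_sub_left, inner_smul_left, h2, mul_zero, sub_zero] at h1
    -- The normals at the two points give `⟨n,v⟩ ≤ 0 ≤ ⟨m,v⟩`, and both lie within `1/4` of `n₀`.
    have hn0 : |inner ℝ (n₀ : E) v| ≤ 1 / 4 * ‖v‖ := by
      have h1 := abs_le.1 (hcs _ hn.le)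
      have h2 := abs_le.1 (hcs _ hm.le)
      have h3 : inner ℝ (n : E) v ≤ 0 := by
        rw [hv, inner_sub_right, real_inner_comm, real_inner_comm ((y : UnitSphere d) : E)]
        simp only [sphereInner] at hxn hyn
        linarith
      have h4 : 0 ≤ inner ℝ (m : E) v := by
        rw [hv, inner_sub_right, real_inner_comm, real_inner_comm ((y : UnitSphere d) : E)]
        simp only [sphereInner] at hym hxm
        linarith
      rw [inner_sub_left] at h1 h2
      exact abs_le.2 ⟨by linarith, by linarith⟩
    have h := hP v
    rw [hdist, dist_eq_norm, ← map_sub]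
    push_cast
    linarith
  have h1 : dimH (Set.univ : Set A) ≤ dimH (Set.univ : Set Uᗮ) := by
    simpa using hanti.dimH_preimage_le Set.univ
  rw [Real.dimH_univ_eq_finrank, hrank] at h1
  rwa [← isometry_subtype_coe.dimH_image, Set.image_univ, Subtype.range_coe] at h1

/-- A subset of the sphere with local supporting normals has Hausdorff dimension at most
`d - 2`. -/
lemma dimH_le_of_local_supporting_normals {S : Set (UnitSphere d)}
    (hS : ∀ x ∈ S, ∃ n : UnitSphere d, sphereInner x n = 0 ∧
      ∀ y ∈ S, dist y x < 1 / 2 → 0 ≤ sphereInner y n) :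
    dimH S ≤ ((d - 2 : ℕ) : ℝ≥0∞) := by
  choose! N hN using hS
  let f : UnitSphere d × UnitSphere d → Set (UnitSphere d × UnitSphere d) :=
    fun p => Metric.ball p (1 / 4)
  -- Covering the graph of `N`, not just `S`, keeps the normals close together too; `N` need not be
  -- continuous.
  obtain ⟨t, htS, htc, htcov⟩ := TopologicalSpace.countable_cover_nhdsWithin
    (f := f) (s := (fun x => (x, N x)) '' S)
    fun p _ => mem_nhdsWithin_of_mem_nhds (Metric.ball_mem_nhds p (by norm_num))
  have hcover : S ⊆ ⋃ p ∈ t, {x ∈ S | (x, N x) ∈ f p} := by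
    intro x hx
    obtain ⟨p, hp, hxp⟩ := Set.mem_iUnion₂.1 (htcov (Set.mem_image_of_mem _ hx))
    exact Set.mem_iUnion₂.2 ⟨p, hp, hx, hxp⟩
  refine (dimH_mono hcover).trans ?_
  rw [dimH_bUnion htc]
  refine iSup₂_le fun p hp => ?_
  obtain ⟨x₀, hx₀, rfl⟩ := htS hp
  refine dimH_le_of_supporting_normals (hN x₀ hx₀).1 fun x hx => ?_
  obtain ⟨hxS, hxp⟩ := hx
  rw [Metric.mem_ball, Prod.dist_eq, max_lt_iff] at hxp
  refine ⟨hxp.1, N x, hxp.2, (hN x hxS).1, fun y hy => (hN x hxS).2 y hy.1 ?_⟩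
  have hyp := hy.2
  rw [Metric.mem_ball, Prod.dist_eq, max_lt_iff] at hyp
  have h1 := dist_triangle_right y x x₀
  have h2 := hyp.1
  have h3 := hxp.1
  dsimp only at h2 h3
  linarith

end Dimension

/-! ### Caps, spherical hulls and their boundaries. -/

section Caps

variable {d : ℕ}

lemma mem_sphericalCap_iff {c z : UnitSphere d} {θ : ℝ} (h0 : 0 ≤ θ) (hpi : θ ≤ Real.pi) :
    z ∈ sphericalCap c θ ↔ Real.cos θ ≤ sphereInner c z := by
  have h := abs_le.1 (abs_sphereInner_le_one c z)
  constructor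
  · intro hz
    rw [← Real.cos_arccos h.1 h.2]
    exact Real.cos_le_cos_of_nonneg_of_le_pi (Real.arccos_nonneg _) hpi hz
  · intro hz
    have := Real.antitone_arccos hz
    rwa [Real.arccos_cos h0 hpi] at this

lemma sphereInner_pos_of_mem_sphericalCap {c x y : UnitSphere d} {θ : ℝ}
    (hpi : θ < Real.pi / 4) (hx : x ∈ sphericalCap c θ) (hy : y ∈ sphericalCap c θ) :
    0 < sphereInner x y := by
  have hang : InnerProductGeometry.angle (x : EuclideanSpace ℝ (Fin d)) y < Real.pi / 2 := by
    have h1 := InnerProductGeometry.angle_le_angle_add_angle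
      (x : EuclideanSpace ℝ (Fin d)) c y
    have h2 : ∀ z ∈ sphericalCap c θ, InnerProductGeometry.angle
        (c : EuclideanSpace ℝ (Fin d)) (z : EuclideanSpace ℝ (Fin d)) ≤ θ := by
      intro z hz
      simpa [InnerProductGeometry.angle, norm_coe_unitSphere] using! hz
    have h3 := h2 x hx
    have h4 := h2 y hy
    rw [InnerProductGeometry.angle_comm] at h3
    linarith
  rw [InnerProductGeometry.angle, Real.arccos_lt_pi_div_two] at hang
  simpa [norm_coe_unitSphere] using! hang

lemma isGeodesicallyConvex_sphericalCap (c : UnitSphere d) {θ : ℝ} (h0 : 0 ≤ θ)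
    (hpi : θ ≤ Real.pi / 2) : IsGeodesicallyConvex (sphericalCap c θ) := by
  intro x hx y hy _ z a b ha hb hz
  have hpi' : θ ≤ Real.pi := by linarith [Real.pi_pos]
  rw [mem_sphericalCap_iff h0 hpi'] at *
  have hcos : 0 ≤ Real.cos θ := Real.cos_nonneg_of_neg_pi_div_two_le_of_le (by linarith) hpi
  -- A chord passes inside the sphere, so normalizing only increases `⟨c,·⟩`, as `cos θ ≥ 0`.
  have hab : 1 ≤ a + b := by
    have h := norm_add_le (a • (x : EuclideanSpace ℝ (Fin d))) (b • (y : EuclideanSpace ℝ (Fin d)))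
    rwa [← hz, norm_smul, norm_smul, norm_coe_unitSphere, norm_coe_unitSphere,
      norm_coe_unitSphere, mul_one, mul_one, Real.norm_of_nonneg ha, Real.norm_of_nonneg hb] at h
  have hcz : sphereInner c z = a * sphereInner c x + b * sphereInner c y := by
    simp only [sphereInner, hz, inner_add_right, inner_smul_right]
  rw [hcz]
  nlinarith [mul_le_mul_of_nonneg_left hx ha, mul_le_mul_of_nonneg_left hy hb]

/-- The spherical bidual of `T`: the intersection of all closed hemispheres containing `T`. -/
def sphericalBidual (T : Set (UnitSphere d)) : Set (UnitSphere d) :=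
  {y | ∀ n : UnitSphere d, (∀ x ∈ T, 0 ≤ sphereInner x n) → 0 ≤ sphereInner y n}

lemma subset_sphericalBidual (T : Set (UnitSphere d)) : T ⊆ sphericalBidual T :=
  fun x hx _ hn => hn x hx

lemma isClosed_sphericalBidual (T : Set (UnitSphere d)) : IsClosed (sphericalBidual T) := by
  simp only [sphericalBidual, Set.ofPred_forall]
  exact isClosed_iInter fun n => isClosed_iInter fun _ =>
    isClosed_le continuous_const (by fun_prop)

lemma isGeodesicallyConvex_sphericalBidual (T : Set (UnitSphere d)) :
    IsGeodesicallyConvex (sphericalBidual T) := by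
  intro x hx y hy _ z a b ha hb hz n hn
  have h1 := hx n hn
  have h2 := hy n hn
  have h3 : sphereInner z n = a * sphereInner x n + b * sphereInner y n := by
    simp only [sphereInner, hz, inner_add_left, inner_smul_left, conj_trivial]
  rw [h3]
  positivity

lemma IsGeodesicallyConvex.inter {K L : Set (UnitSphere d)} (hK : IsGeodesicallyConvex K)
    (hL : IsGeodesicallyConvex L) : IsGeodesicallyConvex (K ∩ L) :=
  fun x hx y hy hxy z a b ha hb hz =>
    ⟨hK x hx.1 y hy.1 hxy z a b ha hb hz, hL x hx.2 y hy.2 hxy z a b ha hb hz⟩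

/-- A point of a closed hemisphere lying on the bounding great sphere is a limit of points of
the complementary open hemisphere. -/
lemma mem_closure_setOf_sphereInner_neg {x n : UnitSphere d} (h : sphereInner x n = 0) :
    x ∈ closure {y : UnitSphere d | sphereInner y n < 0} := by
  -- The great circle leaving `x` in direction `-n`.
  let γ : ℝ → UnitSphere d := fun t =>
    ⟨Real.cos t • (x : EuclideanSpace ℝ (Fin d)) - Real.sin t • (n : EuclideanSpace ℝ (Fin d)), by
      rw [mem_sphere_zero_iff_norm, ← sq_eq_sq₀ (norm_nonneg _) zero_le_one, norm_sub_sq_real,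
        norm_smul, norm_smul, inner_smul_left, inner_smul_right, norm_coe_unitSphere,
        norm_coe_unitSphere]
      simp only [sphereInner] at h
      simp [h]⟩
  have hγ : Continuous γ := by
    refine Continuous.subtype_mk (by fun_prop) _
  have hγ0 : γ 0 = x := by simp [γ]
  have hneg : ∀ t ∈ Set.Ioo (0 : ℝ) 1, sphereInner (γ t) n < 0 := by
    intro t ht
    have h1 : sphereInner (γ t) n = -Real.sin t := by
      have h2 := norm_coe_unitSphere n
      simp only [sphereInner] at h
      simp [sphereInner, γ, inner_sub_left, inner_smul_left, h]
    rw [h1]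
    linarith [Real.sin_pos_of_pos_of_lt_pi ht.1 (by linarith [ht.2, Real.pi_gt_three])]
  have h0 : (0 : ℝ) ∈ closure (Set.Ioo (0 : ℝ) 1) := by
    rw [closure_Ioo zero_ne_one]
    simp
  rw [← hγ0]
  exact map_mem_closure hγ h0 hneg

end Caps

theorem theorem6p2 (d : ℕ) (hd : 2 ≤ d) (μ : Measure (UnitSphere d))
    (hμ : IsThreePointFrameMinimizer μ) :
    dimH μ.support ≤ ((d - 2 : ℕ) : ℝ≥0∞) ∧
      ∀ (c : UnitSphere d) (θ : ℝ), 0 < θ → θ < Real.pi / 4 →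
        ∃ K : Set (UnitSphere d), K ⊆ sphericalCap c θ ∧ IsClosed K ∧ IsGeodesicallyConvex K ∧
          sphericalCap c θ ∩ μ.support ⊆ frontier K := by
  refine ⟨dimH_le_of_local_supporting_normals fun x hx => ?_, fun c θ h0 hθ => ?_⟩
  · obtain ⟨n, hn, hnT⟩ := hμ.exists_supporting_normal hd
      -- Two points within `1/2` of `x` are less than `1` apart, hence have positive inner product.
      (T := {y ∈ μ.support | dist y x < 1 / 2}) (fun y hy => hy.1)
      (fun y hy z hz => sphereInner_pos_of_dist_lt (by
        linarith [dist_triangle_right y z x, hy.2, hz.2])) (x := x) ⟨hx, by simp⟩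
    exact ⟨n, hn, fun y hy hyx => hnT y ⟨hy, hyx⟩⟩
  · have hpi := Real.pi_pos
    set T := sphericalCap c θ ∩ μ.support with hT
    have hcap : IsClosed (sphericalCap c θ) :=
      isClosed_le (Real.continuous_arccos.comp (by fun_prop)) continuous_const
    have hK : IsClosed (sphericalCap c θ ∩ sphericalBidual T) :=
      hcap.inter (isClosed_sphericalBidual T)
    refine ⟨sphericalCap c θ ∩ sphericalBidual T, Set.inter_subset_left, hK,
      (isGeodesicallyConvex_sphericalCap c h0.le (by linarith)).inter
        (isGeodesicallyConvex_sphericalBidual T), fun x hx => ?_⟩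
    obtain ⟨n, hxn, hn⟩ := hμ.exists_supporting_normal hd (T := T) Set.inter_subset_right
      (fun y hy z hz => sphereInner_pos_of_mem_sphericalCap hθ hy.1 hz.1) hx
    -- The hemisphere of `n` contains the bidual of `T`, so points with `⟨·,n⟩ < 0`, which
    -- accumulate at `x`, lie outside `K`.
    rw [frontier_eq_closure_inter_closure, hK.closure_eq]
    refine ⟨⟨hx.1, subset_sphericalBidual T hx⟩,
      closure_mono (fun y hy hyK => ?_) (mem_closure_setOf_sphereInner_neg hxn)⟩
    exact (hyK.2 n hn).not_gt hy
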